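/- For a finite set $H\subset\mathbb{R}^n$ and $x\in\mathbb{R}^n$ let $\mathcal{A}_H(x)=(\mathrm{sign}\langle h,x\rangle : h\in H)\in\{-,0,+\}^H$. A set $S\subset\mathbb{R}^n$ \emph{infers} $h\in\mathbb{R}^n$ at $x$ if $\mathrm{sign}\langle h,x'\rangle=\mathrm{sign}\langle h,x\rangle$ for every $x'\in\mathbb{R}^n$ with $\mathcal{A}_{S\cup(S-S)}(x')=\mathcal{A}_{S\cup(S-S)}(x)$, where $S-S=\{h'-h'':h',h''\in S\}$. The \emph{inference dimension} of $H$ is the minimal $d\ge 1$ such that for every $S\subseteq H$ with $|S|\ge d$ and every $x\in\mathbb{R}^n$ there is $h\in S$ such that $S\setminus\{h\}$ infers $h$ at $x$. A \emph{comparison decision tree} for $H$ is a (deterministic) ternary decision tree in which every inner node queries $\mathrm{sign}\langle h,x\rangle$ for some $h\in H$ or $\mathrm{sign}\langle h'-h'',x\rangle$ for some $h',h''\in H$ and branches on the answer in $\{-,0,+\}$. Its \emph{query complexity} is the maximum over $x\in\mathbb{R}^n$ of the number of queries performed on input $x$. \textbf{Theorem.} There is an absolute constant $C>0$ such that the following holds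 for every $n$. Let $H\subset\mathbb{R}^n$ be a finite set with $|H|\ge 2$ and with inference dimension $d$. Then there exists a comparison decision tree for $H$ which computes $\mathcal{A}_H(x)$ correctly on every input $x\in\mathbb{R}^n$ and whose query complexity is at most $$C\,\bigl(d+n\log(nd)\bigr)\log|H|.$$ -/

import Mathlib

namespace PointLocation

open scoped Pointwise

/-- The sign pattern `𝒜_H(x) = (sign ⟨h, x⟩ : h ∈ H) ∈ {-, 0, +}^H`. -/
noncomputable def signVector {n : ℕ} (H : Set (EuclideanSpace ℝ (Fin n)))
    (x : EuclideanSpace ℝ (Fin n)) : H → SignType :=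
  fun h => SignType.sign (inner ℝ (h : EuclideanSpace ℝ (Fin n)) x)

/-- The vectors `S ∪ (S - S)` of the label queries `h ∈ S` and of the comparison queries
`h' - h''`, `h', h'' ∈ S`. -/
def queryVectors {n : ℕ} (S : Set (EuclideanSpace ℝ (Fin n))) :
    Set (EuclideanSpace ℝ (Fin n)) :=
  S ∪ (S - S)

/-- `S` infers `h` at `x`: the sign of `⟨h, x⟩` is determined by the answers at `x` to the label
and comparison queries on `S`. -/
def Infers {n : ℕ} (S : Set (EuclideanSpace ℝ (Fin n))) (h x : EuclideanSpace ℝ (Fin n)) : Prop :=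
  ∀ x' : EuclideanSpace ℝ (Fin n),
    signVector (queryVectors S) x' = signVector (queryVectors S) x →
      (SignType.sign (inner ℝ h x') : SignType) = SignType.sign (inner ℝ h x)

/-- `d` is the inference dimension of `H`: the minimal `d ≥ 1` such that for every `S ⊆ H` with
`|S| ≥ d` and every `x` there is `h ∈ S` such that `S \ {h}` infers `h` at `x`. -/
def IsInferenceDimension {n : ℕ} (H : Set (EuclideanSpace ℝ (Fin n))) (d : ℕ) : Prop :=
  IsLeast {k : ℕ | 1 ≤ k ∧ ∀ S ⊆ H, (k : ℕ∞) ≤ S.encard →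
    ∀ x : EuclideanSpace ℝ (Fin n), ∃ h ∈ S, Infers (S \ {h}) h x} d

/-- Ternary linear decision trees on inputs in `ℝⁿ` with outputs in `α`: an inner node asks for the
sign of `⟨q, x⟩` and branches on the answer. -/
inductive LinearDecisionTree (n : ℕ) (α : Type*) where
  | leaf (output : α) : LinearDecisionTree n α
  | node (q : EuclideanSpace ℝ (Fin n)) (child : SignType → LinearDecisionTree n α) :
      LinearDecisionTree n α

namespace LinearDecisionTree

/-- The output of the tree on input `x`. -/
noncomputable def eval {n : ℕ} {α : Type*} :
    LinearDecisionTree n α → EuclideanSpace ℝ (Fin n) → α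
  | leaf output, _ => output
  | node q child, x => (child (SignType.sign (inner ℝ q x))).eval x

/-- The number of queries performed by the tree on input `x`. -/
noncomputable def numQueries {n : ℕ} {α : Type*} :
    LinearDecisionTree n α → EuclideanSpace ℝ (Fin n) → ℕ
  | leaf _, _ => 0
  | node q child, x => (child (SignType.sign (inner ℝ q x))).numQueries x + 1

/-- A comparison decision tree for `H`: all its queries are label queries `sign ⟨h, x⟩`, `h ∈ H`,
or comparison queries `sign ⟨h' - h'', x⟩`, `h', h'' ∈ H`. -/
def IsComparisonTree {n : ℕ} {α : Type*} (H : Set (EuclideanSpace ℝ (Fin n))) :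
    LinearDecisionTree n α → Prop
  | leaf _ => True
  | node q child => q ∈ queryVectors H ∧ ∀ s, (child s).IsComparisonTree H

end LinearDecisionTree

end PointLocation

/-!
Call `h` inferred by a sample `S` at `x` when the answers to the label and comparison queries on
`S` at `x` determine `sign ⟪h, x⟫`. Some sample of `2k` vectors, `k = O(d + n log (nd))`, infers
at least a quarter of the vectors at every `x` simultaneously. Otherwise every sample `S` has a
bad point `X S`, and by double sampling there is a `4k`-set `Q` such that for many `2k`-subsets
`S` of `Q` nothing in `Q \ S` is inferred by `S` at `X S`; call such `S` closed. For a fixed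
point, a `d`-subset of `Q` contains an element inferred by the others and so is not shattered by
closed sets, hence Sauer–Shelah bounds the number of closed sets. Only the cell of `X S` in the
arrangement of the queries on `Q` matters, and there are at most `(2(4k + 1)² + 1)ⁿ` cells.

The queries on `S` are all answered by sorting `S ∪ {0}` by insertion. Two comparisons with
well-chosen pivots either place the new element or halve the number of possible orders; as there
are only `|S|^O(n)` orders, this costs `O(|S| + n log |S|)` comparisons in total. Hence
`O(log |H|)` rounds, each on the vectors which the previous ones have not inferred, suffice.
-/

namespace PointLocation

open SignType (sign)

section Combinatorics

open Finset

theorem card_filter_card_le_mul_pow_le {α : Type*} (Q : Finset α) (d : ℕ) {t : ℕ} (ht : 1 ≤ t) :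
    #{D ∈ Q.powerset | #D ≤ d} * t ^ #Q ≤ t ^ d * (t + 1) ^ #Q := by
  calc #{D ∈ Q.powerset | #D ≤ d} * t ^ #Q
      = ∑ D ∈ Q.powerset with #D ≤ d, t ^ #Q := by rw [sum_const, smul_eq_mul]
    _ ≤ ∑ D ∈ Q.powerset with #D ≤ d, t ^ d * t ^ (#Q - #D) := by
        refine sum_le_sum fun D hD => ?_
        rw [← pow_add]
        have := (mem_filter.1 hD).2
        exact Nat.pow_le_pow_right ht (by omega)
    _ ≤ ∑ D ∈ Q.powerset, t ^ d * t ^ (#Q - #D) :=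
        sum_le_sum_of_subset (filter_subset _ _)
    _ = t ^ d * (t + 1) ^ #Q := by
        rw [← mul_sum, add_comm t 1]
        simpa only [one_pow, one_mul] using congrArg (t ^ d * ·) (sum_pow_mul_eq_add_pow 1 t Q)

theorem choose_le_pow_mul_choose {a b c m : ℕ} (h : ∀ i < m, a - i ≤ c * (b - i)) :
    a.choose m ≤ c ^ m * b.choose m := by
  have hdesc : a.descFactorial m ≤ c ^ m * b.descFactorial m := by
    rw [Nat.descFactorial_eq_prod_range, Nat.descFactorial_eq_prod_range,
      ← card_range m, ← prod_const, card_range, ← prod_mul_distrib]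
    exact prod_le_prod' fun i hi => h i (mem_range.1 hi)
  rw [Nat.descFactorial_eq_factorial_mul_choose, Nat.descFactorial_eq_factorial_mul_choose,
    mul_left_comm] at hdesc
  exact Nat.le_of_mul_le_mul_left hdesc m.factorial_pos

variable {α : Type*} [DecidableEq α]

/-- Sauer–Shelah: a set `D` with a point `h` inferred by `D \ {h}` is not shattered by closed
sets. -/
theorem card_le_card_filter_card_lt_of_closed {I : Finset α → α → Prop} (hI : Monotone I)
    {Q : Finset α} {d : ℕ} (hQ : ∀ D ⊆ Q, d ≤ #D → ∃ h ∈ D, I (D.erase h) h)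
    {𝒜 : Finset (Finset α)} (h𝒜 : ∀ S ∈ 𝒜, S ⊆ Q ∧ ∀ h ∈ Q, I S h → h ∈ S) :
    #𝒜 ≤ #{D ∈ Q.powerset | #D < d} := by
  refine (card_le_card_shatterer 𝒜).trans (card_le_card fun D hD => ?_)
  rw [mem_shatterer] at hD
  have hDQ : D ⊆ Q := by
    obtain ⟨S, hS, hDS⟩ := hD subset_rfl
    exact (inter_eq_left.1 hDS).trans (h𝒜 S hS).1
  refine mem_filter.2 ⟨mem_powerset.2 hDQ, ?_⟩
  by_contra! hdD
  obtain ⟨h, hhD, hinf⟩ := hQ D hDQ hdD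
  obtain ⟨S, hS, hDS⟩ := hD (erase_subset h D)
  have hsub : D.erase h ⊆ S := hDS ▸ inter_subset_right
  have hhS : h ∈ S := (h𝒜 S hS).2 h (hDQ hhD) (hI hsub h hinf)
  exact notMem_erase h D (hDS ▸ mem_inter.2 ⟨hhD, hhS⟩)

theorem choose_card_le_card_filter_sdiff_subset {H S U : Finset α} {m : ℕ} (hSH : S ⊆ H)
    (hUH : U ⊆ H \ S) :
    (#U).choose m ≤ #{Q ∈ H.powersetCard (#S + m) | S ⊆ Q ∧ Q \ S ⊆ U} := by
  have hcancel : ∀ W ⊆ U, (S ∪ W) \ S = W := fun W hW =>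
    union_sdiff_cancel_left (disjoint_of_subset_right (hW.trans hUH) disjoint_sdiff)
  rw [← card_powersetCard]
  refine card_le_card_of_injOn (S ∪ ·) (fun W hW => ?_)
    (Set.LeftInvOn.injOn (f₁' := (· \ S)) fun W hW => hcancel W (mem_powersetCard.1 hW).1)
  obtain ⟨hWU, hWm⟩ := mem_powersetCard.1 hW
  have hWS : W ⊆ H \ S := hWU.trans hUH
  refine mem_coe.2 (mem_filter.2 ⟨mem_powersetCard.2 ⟨?_, ?_⟩, subset_union_left, ?_⟩)
  · exact union_subset hSH (hWS.trans sdiff_subset)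
  · rw [card_union_of_disjoint (disjoint_of_subset_right hWS disjoint_sdiff), hWm]
  · rwa [hcancel W hWU]

/-- The double sampling argument: count the pairs `S ⊆ Q` with `#S = m`, `#Q = 2 * m` and
`Q \ S ⊆ U S` from both sides. -/
theorem centralBinom_le_two_pow_mul {H : Finset α} {m M : ℕ} (hm : 4 * m ≤ #H)
    (U : Finset α → Finset α)
    (hU : ∀ S ∈ H.powersetCard m, U S ⊆ H \ S ∧ 3 * #H ≤ 4 * #(U S))
    (hM : ∀ Q ∈ H.powersetCard (2 * m), #{S ∈ Q.powersetCard m | Q \ S ⊆ U S} ≤ M) :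
    m.centralBinom ≤ 2 ^ m * M := by
  set N := #H with hN
  set u := (3 * N + 3) / 4
  have hcount : N.choose m * u.choose m ≤ N.choose (2 * m) * M := by
    simp only [hN, ← card_powersetCard _ H]
    refine card_mul_le_card_mul (fun S Q => S ⊆ Q ∧ Q \ S ⊆ U S) (fun S hS => ?_) fun Q hQ => ?_
    · obtain ⟨hSH, rfl⟩ := mem_powersetCard.1 hS
      rw [two_mul]
      exact (Nat.choose_le_choose _ (by have := (hU S hS).2; omega)).trans
        (choose_card_le_card_filter_sdiff_subset hSH (hU S hS).1)
    · refine (card_le_card fun S hS => ?_).trans (hM Q hQ)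
      obtain ⟨hS, hSQ, hQS⟩ := mem_filter.1 hS
      exact mem_filter.2 ⟨mem_powersetCard.2 ⟨hSQ, (mem_powersetCard.1 hS).2⟩, hQS⟩
  have hhalf : (N - m).choose m ≤ 2 ^ m * u.choose m :=
    choose_le_pow_mul_choose fun i hi => by omega
  refine Nat.le_of_mul_le_mul_left (c := N.choose (2 * m)) ?_ (Nat.choose_pos (by omega))
  calc N.choose (2 * m) * m.centralBinom
      = N.choose m * (N - m).choose m := by
        rw [Nat.centralBinom_eq_two_mul_choose, Nat.choose_mul (by omega)]
        congr 2
        omega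
    _ ≤ N.choose m * (2 ^ m * u.choose m) := Nat.mul_le_mul_left _ hhalf
    _ = 2 ^ m * (N.choose m * u.choose m) := mul_left_comm _ _ _
    _ ≤ 2 ^ m * (N.choose (2 * m) * M) := Nat.mul_le_mul_left _ hcount
    _ = N.choose (2 * m) * (2 ^ m * M) := mul_left_comm _ _ _

end Combinatorics

section SignPatterns

variable {ι K V : Type*} [Field K] [LinearOrder K] [AddCommGroup V] [Module K V]

/-- The signs at `x` of a family of linear forms: the cell of `x` in the central arrangement of
the hyperplanes where the forms vanish. -/
def signPattern (f : ι → Module.Dual K V) (x : V) : ι → SignType :=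
  fun i => sign (f i x)

theorem ncard_signPattern_option_image_le [Finite ι] (f : Option ι → Module.Dual K V)
    (s : SignType) :
    (signPattern f '' {x | sign (f none x) = s}).ncard ≤
      (signPattern (f ∘ some) '' {x | sign (f none x) = s}).ncard := by
  refine (Set.ncard_le_ncard (t := (fun p i => i.elim s p) '' _) ?_ (Set.toFinite _)).trans
    (Set.ncard_image_le (Set.toFinite _))
  rintro _ ⟨x, hx, rfl⟩
  refine ⟨_, ⟨x, hx, rfl⟩, funext ?_⟩
  rintro (_ | i)
  · exact hx.symm
  · rfl

theorem signPattern_image_sign_eq_zero (f : ι → Module.Dual K V) (a : Module.Dual K V) :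
    signPattern f '' {x | sign (a x) = 0} =
      Set.range (signPattern fun i => (f i).domRestrict a.ker) := by
  ext p
  simp [signPattern, funext_iff]

variable [IsStrictOrderedRing K]

theorem sign_mul_add_mul_of_sign_eq {a b c e : K} (ha : 0 < a) (hb : 0 < b)
    (h : sign c = sign e) : sign (a * c + b * e) = sign c := by
  rcases lt_trichotomy c 0 with hc | rfl | hc
  · have he : e < 0 := by rwa [sign_neg hc, eq_comm, sign_eq_neg_one_iff] at h
    rw [sign_neg hc, sign_neg (add_neg (mul_neg_of_pos_of_neg ha hc) (mul_neg_of_pos_of_neg hb he))]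
  · obtain rfl : e = 0 := by rwa [sign_zero, eq_comm, sign_eq_zero_iff] at h
    simp
  · have he : 0 < e := by rwa [sign_pos hc, eq_comm, sign_eq_one_iff] at h
    rw [sign_pos hc, sign_pos (add_pos (mul_pos ha hc) (mul_pos hb he))]

/-- The segment between two points of the same cell on opposite sides of a hyperplane crosses the
hyperplane within the cell. -/
theorem signPattern_image_pos_inter_image_neg_subset (f : ι → Module.Dual K V)
    (a : Module.Dual K V) :
    signPattern f '' {x | sign (a x) = 1} ∩ signPattern f '' {x | sign (a x) = -1} ⊆
      signPattern f '' {x | sign (a x) = 0} := by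
  rintro _ ⟨⟨x, hx, rfl⟩, y, hy, hxy⟩
  rw [Set.mem_ofPred_eq, sign_eq_one_iff] at hx
  rw [Set.mem_ofPred_eq, sign_eq_neg_one_iff] at hy
  refine ⟨(-a y) • x + a x • y, ?_, funext fun i => ?_⟩
  · rw [Set.mem_ofPred_eq, sign_eq_zero_iff, map_add, map_smul, map_smul, smul_eq_mul, smul_eq_mul]
    ring
  · simpa [signPattern] using
      sign_mul_add_mul_of_sign_eq (neg_pos.2 hy) hx (congrFun hxy i).symm

theorem ncard_range_signPattern_option_le [Finite ι] (f : Option ι → Module.Dual K V) :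
    (Set.range (signPattern f)).ncard ≤ (Set.range (signPattern (f ∘ some))).ncard +
      2 * (signPattern (f ∘ some) '' {x | sign (f none x) = 0}).ncard := by
  set cells : SignType → Set (ι → SignType) :=
    fun s => signPattern (f ∘ some) '' {x | sign (f none x) = s}
  change _ ≤ _ + 2 * (cells 0).ncard
  have hsplit : (Set.range (signPattern f)).ncard ≤ ∑ s, (cells s).ncard := by
    have hcover : Set.range (signPattern f) = ⋃ s, signPattern f '' {x | sign (f none x) = s} := by
      rw [← Set.image_iUnion, ← Set.image_univ]
      congr
      ext x
      simp
    rw [hcover]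
    exact (Set.ncard_iUnion_le_of_fintype _).trans
      (Finset.sum_le_sum fun s _ => ncard_signPattern_option_image_le f s)
  have hsum : ∑ s, (cells s).ncard =
      (cells 0).ncard + ((cells (-1)).ncard + (cells 1).ncard) := by
    simp [SignType.univ_eq]
  have hunion : (cells 1 ∪ cells (-1)).ncard ≤ (Set.range (signPattern (f ∘ some))).ncard :=
    Set.ncard_le_ncard (Set.union_subset (Set.image_subset_range _ _)
      (Set.image_subset_range _ _)) (Set.toFinite _)
  have hinter : (cells 1 ∩ cells (-1)).ncard ≤ (cells 0).ncard :=
    Set.ncard_le_ncard (signPattern_image_pos_inter_image_neg_subset _ _) (Set.toFinite _)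
  have := Set.ncard_union_add_ncard_inter (cells 1) (cells (-1))
  omega

theorem ncard_range_signPattern_le [Finite ι] [FiniteDimensional K V]
    (f : ι → Module.Dual K V) :
    (Set.range (signPattern f)).ncard ≤ (2 * Nat.card ι + 1) ^ Module.finrank K V := by
  induction ι using Finite.induction_empty_option generalizing V with
  | @of_equiv ι κ e ih =>
    have hrange : Set.range (signPattern f) =
        (· ∘ e.symm) '' Set.range (signPattern (f ∘ e)) := by
      rw [← Set.range_comp]
      refine congrArg Set.range (funext₂ fun x i => ?_)
      simp [signPattern]
    rw [hrange, Set.ncard_image_of_injective _ e.symm.surjective.injective_comp_right,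
      ← Nat.card_congr e]
    exact ih _
  | h_empty => simpa using Set.ncard_le_one_of_subsingleton (Set.range (signPattern f))
  | @h_option ι _ ih =>
    rw [Finite.card_option]
    by_cases hf : f none = 0
    · have hle := ncard_signPattern_option_image_le f 0
      simp only [hf, LinearMap.zero_apply, sign_zero, Set.ofPred_true, Set.image_univ] at hle
      exact hle.trans ((ih _).trans (Nat.pow_le_pow_left (by omega) _))
    · have hker : Module.finrank K (f none).ker + 1 = Module.finrank K V :=
        Module.Dual.finrank_ker_add_one_of_ne_zero hf
      have hrec := ncard_range_signPattern_option_le f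
      rw [signPattern_image_sign_eq_zero] at hrec
      calc (Set.range (signPattern f)).ncard
          ≤ (2 * Nat.card ι + 1) ^ Module.finrank K V +
              2 * (2 * Nat.card ι + 1) ^ Module.finrank K (f none).ker :=
            hrec.trans (Nat.add_le_add (ih _) (Nat.mul_le_mul_left 2 (ih _)))
        _ = (2 * Nat.card ι + 1) ^ Module.finrank K (f none).ker * (2 * (Nat.card ι + 1) + 1) := by
            rw [← hker]
            ring
        _ ≤ (2 * (Nat.card ι + 1) + 1) ^ Module.finrank K V := by
            rw [← hker, pow_succ]
            gcongr
            omega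

end SignPatterns

open Set
open scoped Finset Pointwise RealInnerProductSpace

variable {n : ℕ}

section SignVector

variable {S T : Set (EuclideanSpace ℝ (Fin n))} {x y : EuclideanSpace ℝ (Fin n)}

theorem signVector_eq_signVector_iff :
    signVector S x = signVector S y ↔ ∀ h ∈ S, sign ⟪h, x⟫ = sign ⟪h, y⟫ := by
  simp [signVector, funext_iff]

theorem signVector_eq_of_subset (hST : S ⊆ T) (h : signVector T x = signVector T y) :
    signVector S x = signVector S y :=
  signVector_eq_signVector_iff.2 fun a ha => signVector_eq_signVector_iff.1 h a (hST ha)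

theorem finite_image_signVector (hS : S.Finite) (A : Set (EuclideanSpace ℝ (Fin n))) :
    (signVector S '' A).Finite :=
  have := hS.to_subtype
  toFinite _

theorem ncard_range_signVector_le (hS : S.Finite) :
    (range (signVector S)).ncard ≤ (2 * S.ncard + 1) ^ n := by
  have := hS.to_subtype
  have hle := ncard_range_signPattern_le fun h : S => innerₛₗ ℝ (h : EuclideanSpace ℝ (Fin n))
  rwa [finrank_euclideanSpace_fin, Nat.card_coe_set_eq] at hle

theorem queryVectors_mono (hST : S ⊆ T) : queryVectors S ⊆ queryVectors T :=
  union_subset_union hST (sub_subset_sub hST hST)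

theorem queryVectors_subset_insert_zero_sub (S : Set (EuclideanSpace ℝ (Fin n))) :
    queryVectors S ⊆ insert 0 S - insert 0 S :=
  union_subset (fun h hh => ⟨h, mem_insert_of_mem _ hh, 0, mem_insert _ _, sub_zero h⟩)
    (sub_subset_sub (subset_insert _ _) (subset_insert _ _))

theorem finite_insert_zero_sub (hS : S.Finite) : (insert 0 S - insert 0 S).Finite :=
  (hS.insert 0).sub (hS.insert 0)

theorem ncard_range_signVector_le_of_subset_sub (hS : S.Finite)
    (hT : T ⊆ insert 0 S - insert 0 S) :
    (range (signVector T)).ncard ≤ (2 * (S.ncard + 1) ^ 2 + 1) ^ n := by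
  have hfin := finite_insert_zero_sub hS
  have hcard : T.ncard ≤ (S.ncard + 1) ^ 2 := by
    calc T.ncard ≤ (insert 0 S - insert 0 S).ncard := ncard_le_ncard hT hfin
      _ ≤ (insert 0 S).ncard * (insert 0 S).ncard := by
        simpa only [← Nat.card_coe_set_eq] using natCard_sub_le
      _ ≤ (S.ncard + 1) ^ 2 := by
        rw [sq]
        exact Nat.mul_le_mul (ncard_insert_le 0 S) (ncard_insert_le 0 S)
  exact (ncard_range_signVector_le (hfin.subset hT)).trans (Nat.pow_le_pow_left (by omega) n)

end SignVector

section DecisionTrees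

variable {α β : Type*} {H : Set (EuclideanSpace ℝ (Fin n))}

/-- The tree which runs `T` and then, on output `a`, the tree `U a`. -/
def LinearDecisionTree.bind (T : LinearDecisionTree n α) (U : α → LinearDecisionTree n β) :
    LinearDecisionTree n β :=
  match T with
  | leaf a => U a
  | node q child => node q fun s => (child s).bind U

theorem LinearDecisionTree.eval_bind (T : LinearDecisionTree n α)
    (U : α → LinearDecisionTree n β) (x : EuclideanSpace ℝ (Fin n)) :
    (T.bind U).eval x = (U (T.eval x)).eval x := by
  induction T with
  | leaf a => rfl
  | node _ _ ih => exact ih _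

theorem LinearDecisionTree.numQueries_bind (T : LinearDecisionTree n α)
    (U : α → LinearDecisionTree n β) (x : EuclideanSpace ℝ (Fin n)) :
    (T.bind U).numQueries x = T.numQueries x + (U (T.eval x)).numQueries x := by
  induction T with
  | leaf a => exact (zero_add _).symm
  | node _ _ ih => exact (congrArg (· + 1) (ih _)).trans (add_right_comm _ _ _)

theorem LinearDecisionTree.IsComparisonTree.bind {T : LinearDecisionTree n α}
    {U : α → LinearDecisionTree n β} (hT : T.IsComparisonTree H)
    (hU : ∀ a, (U a).IsComparisonTree H) : (T.bind U).IsComparisonTree H := by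
  induction T with
  | leaf a => exact hU a
  | node _ _ ih => exact ⟨hT.1, fun s => ih s (hT.2 s)⟩

/-- Some comparison tree for `H` computes `g` on all inputs from `A` with at most `k` queries;
nothing is required of the tree outside `A`. -/
def ComputableWithin (H A : Set (EuclideanSpace ℝ (Fin n))) (g : EuclideanSpace ℝ (Fin n) → α)
    (k : ℕ) : Prop :=
  ∃ T : LinearDecisionTree n α, T.IsComparisonTree H ∧
    ∀ x ∈ A, T.eval x = g x ∧ T.numQueries x ≤ k

namespace ComputableWithin

variable {A B : Set (EuclideanSpace ℝ (Fin n))} {f : EuclideanSpace ℝ (Fin n) → α}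
  {g : EuclideanSpace ℝ (Fin n) → β} {k l : ℕ}

theorem mono (h : ComputableWithin H A g k) (hBA : B ⊆ A) (hkl : k ≤ l) :
    ComputableWithin H B g l := by
  obtain ⟨T, hT, hTA⟩ := h
  exact ⟨T, hT, fun x hx => ⟨(hTA x (hBA hx)).1, (hTA x (hBA hx)).2.trans hkl⟩⟩

theorem of_const (h : ∀ x ∈ A, ∀ y ∈ A, g x = g y) : ComputableWithin H A g k := by
  obtain rfl | ⟨y, hy⟩ := A.eq_empty_or_nonempty
  · exact ⟨.leaf (g 0), trivial, fun x hx => hx.elim⟩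
  · exact ⟨.leaf (g y), trivial, fun x hx => ⟨h y hy x hx, Nat.zero_le k⟩⟩

theorem bind (hf : ComputableWithin H A f k)
    (hg : ∀ a, ComputableWithin H {x ∈ A | f x = a} g l) : ComputableWithin H A g (k + l) := by
  obtain ⟨T, hT, hTA⟩ := hf
  choose U hU hUA using hg
  refine ⟨T.bind U, hT.bind hU, fun x hx => ?_⟩
  rw [T.eval_bind, T.numQueries_bind, (hTA x hx).1]
  obtain ⟨heval, hnum⟩ := hUA (f x) x ⟨hx, rfl⟩
  exact ⟨heval, Nat.add_le_add (hTA x hx).2 hnum⟩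

theorem of_factors (hf : ComputableWithin H A f k)
    (hg : ∀ x ∈ A, ∀ y ∈ A, f x = f y → g x = g y) : ComputableWithin H A g k :=
  hf.bind (l := 0) fun _ => of_const fun x hx y hy => hg x hx.1 y hy.1 (hx.2.trans hy.2.symm)

theorem sign_inner {q : EuclideanSpace ℝ (Fin n)} (hq : q ∈ queryVectors H) :
    ComputableWithin H A (fun x => sign ⟪q, x⟫) 1 :=
  ⟨.node q .leaf, ⟨hq, fun _ => trivial⟩, fun _ _ => ⟨rfl, le_rfl⟩⟩

theorem of_signVector_eq (R : Finset (EuclideanSpace ℝ (Fin n))) (hR : ↑R ⊆ H)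
    (hg : ∀ x ∈ A, ∀ y ∈ A, signVector R x = signVector R y → g x = g y) :
    ComputableWithin H A g #R := by
  classical
  induction R using Finset.induction_on generalizing A with
  | empty =>
    exact of_const fun x hx y hy => hg x hx y hy (signVector_eq_signVector_iff.2 (by simp))
  | insert h R hh ih =>
    rw [Finset.coe_insert, insert_subset_iff] at hR
    rw [Finset.card_insert_of_notMem hh, add_comm]
    refine (sign_inner (Or.inl hR.1)).bind fun s => ih hR.2 fun x hx y hy hxy => ?_
    refine hg x hx.1 y hy.1 (signVector_eq_signVector_iff.2 ?_)
    rw [Finset.coe_insert, forall_mem_insert]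
    exact ⟨hx.2.trans hy.2.symm, signVector_eq_signVector_iff.1 hxy⟩

theorem compare {a b : EuclideanSpace ℝ (Fin n)} (hH : H.Nonempty)
    (ha : a ∈ insert 0 H) (hb : b ∈ insert 0 H)
    (hlt : ComputableWithin H {x ∈ A | ⟪a, x⟫ < ⟪b, x⟫} g k)
    (heq : ComputableWithin H {x ∈ A | ⟪a, x⟫ = ⟪b, x⟫} g k)
    (hgt : ComputableWithin H {x ∈ A | ⟪b, x⟫ < ⟪a, x⟫} g k) :
    ComputableWithin H A g (k + 1) := by
  wlog hq : a - b ∈ queryVectors H generalizing a b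
  · refine this hb ha hgt (by simpa only [eq_comm] using heq) hlt ?_
    rcases ha with rfl | ha <;> rcases hb with rfl | hb
    · obtain ⟨c, hc⟩ := hH
      exact Or.inr ⟨c, hc, c, hc, by simp⟩
    · exact Or.inl (by simpa using hb)
    · exact absurd (Or.inl (by simpa using ha)) hq
    · exact absurd (Or.inr (sub_mem_sub ha hb)) hq
  rw [add_comm]
  refine (sign_inner hq).bind fun s => ?_
  rcases s with _ | _ | _
  · simpa [sign_eq_zero_iff, inner_sub_left, sub_eq_zero] using heq
  · simpa [sign_eq_neg_one_iff, inner_sub_left] using hlt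
  · simpa [sign_eq_one_iff, inner_sub_left] using hgt

end ComputableWithin

end DecisionTrees

section Sorting

variable {α : Type*} {H S T A B : Set (EuclideanSpace ℝ (Fin n))}
  {a b c x y : EuclideanSpace ℝ (Fin n)}

/-- The linear forms from `T` are ordered in the same way at all points of `A`. -/
def OrderConstOn (T A : Set (EuclideanSpace ℝ (Fin n))) : Prop :=
  ∀ x ∈ A, ∀ y ∈ A, ∀ a ∈ T, ∀ b ∈ T, ⟪a, x⟫ < ⟪b, x⟫ → ⟪a, y⟫ < ⟪b, y⟫

namespace OrderConstOn

theorem mono (h : OrderConstOn T A) (hST : S ⊆ T) (hBA : B ⊆ A) : OrderConstOn S B :=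
  fun x hx y hy a ha b hb => h x (hBA hx) y (hBA hy) a (hST ha) b (hST hb)

theorem inner_le (h : OrderConstOn T A) (hx : x ∈ A) (hy : y ∈ A) (ha : a ∈ T) (hb : b ∈ T)
    (hab : ⟪a, x⟫ ≤ ⟪b, x⟫) : ⟪a, y⟫ ≤ ⟪b, y⟫ :=
  le_of_not_gt fun hlt => hab.not_gt (h y hy x hx b hb a ha hlt)

theorem insert_of_eq (h : OrderConstOn T A) (ha : a ∈ T) (hc : ∀ x ∈ A, ⟪c, x⟫ = ⟪a, x⟫) :
    OrderConstOn (insert c T) A := by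
  rintro x hx y hy e (rfl | he) f (rfl | hf)
  · simp
  · rw [hc x hx, hc y hy]
    exact h x hx y hy a ha f hf
  · rw [hc x hx, hc y hy]
    exact h x hx y hy e he a ha
  · exact h x hx y hy e he f hf

theorem insert_of_lt_or_gt (h : OrderConstOn T A)
    (hc : ∀ e ∈ T, (∀ x ∈ A, ⟪e, x⟫ < ⟪c, x⟫) ∨ ∀ x ∈ A, ⟪c, x⟫ < ⟪e, x⟫) :
    OrderConstOn (insert c T) A := by
  rintro x hx y hy e (rfl | he) f (rfl | hf) hlt
  · exact absurd hlt (lt_irrefl _)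
  · exact (hc f hf).elim (fun hf' => absurd hlt (hf' x hx).not_gt) fun hf' => hf' y hy
  · exact (hc e he).elim (fun he' => he' y hy) fun he' => absurd hlt (he' x hx).not_gt
  · exact h x hx y hy e he f hf hlt

theorem signVector_sub_eq (h : OrderConstOn T A) (hx : x ∈ A) (hy : y ∈ A) :
    signVector (T - T) x = signVector (T - T) y := by
  rw [signVector_eq_signVector_iff]
  rintro _ ⟨a, ha, b, hb, rfl⟩
  simp only [inner_sub_left]
  rcases lt_trichotomy ⟪a, x⟫ ⟪b, x⟫ with hlt | heq | hgt
  · rw [sign_neg (sub_neg.2 hlt), sign_neg (sub_neg.2 (h x hx y hy a ha b hb hlt))]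
  · have heq' := le_antisymm (h.inner_le hx hy ha hb heq.le) (h.inner_le hx hy hb ha heq.ge)
    rw [heq, heq', sub_self, sub_self]
  · rw [sign_pos (sub_pos.2 hgt), sign_pos (sub_pos.2 (h x hx y hy b hb a ha hgt))]

end OrderConstOn

theorem inner_lt_of_signVector_sub_eq (hxy : signVector (T - T) x = signVector (T - T) y)
    (ha : a ∈ T) (hb : b ∈ T) (hab : ⟪a, x⟫ < ⟪b, x⟫) : ⟪a, y⟫ < ⟪b, y⟫ := by
  have hsign := signVector_eq_signVector_iff.1 hxy (a - b) (sub_mem_sub ha hb)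
  simp only [inner_sub_left] at hsign
  rwa [sign_neg (sub_neg.2 hab), eq_comm, sign_eq_neg_one_iff, sub_neg] at hsign

/-- The number of ways in which the linear forms from `T` are ordered at the points of `A`; an
order is recorded by the signs of the differences. -/
noncomputable def numOrders (T A : Set (EuclideanSpace ℝ (Fin n))) : ℕ :=
  (signVector (T - T) '' A).ncard

theorem numOrders_mono (hT : T.Finite) (hBA : B ⊆ A) : numOrders T B ≤ numOrders T A :=
  ncard_le_ncard (image_mono hBA) (finite_image_signVector (hT.sub hT) A)

theorem numOrders_pos (hT : T.Finite) (hA : A.Nonempty) : 0 < numOrders T A :=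
  (ncard_pos (finite_image_signVector (hT.sub hT) A)).2 (hA.image _)

theorem numOrders_insert_zero_le (hS : S.Finite) :
    numOrders (insert 0 S) A ≤ (2 * (S.ncard + 1) ^ 2 + 1) ^ n := by
  have hfin := finite_image_signVector (finite_insert_zero_sub hS) univ
  rw [image_univ] at hfin
  exact (ncard_le_ncard (image_subset_range _ _) hfin).trans
    (ncard_range_signVector_le_of_subset_sub hS subset_rfl)

theorem numOrders_lt_add_numOrders_gt_le (hT : T.Finite) (ha : a ∈ T) (hb : b ∈ T) :
    numOrders T {x ∈ A | ⟪a, x⟫ < ⟪b, x⟫} + numOrders T {x ∈ A | ⟪b, x⟫ < ⟪a, x⟫} ≤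
      numOrders T A := by
  have hfin := finite_image_signVector (hT.sub hT)
  rw [numOrders, numOrders, ← ncard_union_eq ?_ (hfin _) (hfin _)]
  · exact ncard_le_ncard (union_subset (image_mono (sep_subset _ _))
      (image_mono (sep_subset _ _))) (hfin A)
  · rw [disjoint_left]
    rintro _ ⟨x, hx, rfl⟩ ⟨y, hy, hyx⟩
    exact hx.2.not_gt (inner_lt_of_signVector_sub_eq hyx hb ha hy.2)

namespace ComputableWithin

variable {g : EuclideanSpace ℝ (Fin n) → α} {k : ℕ}

theorem compare_max {L : Finset (EuclideanSpace ℝ (Fin n))} (hH : H.Nonempty)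
    (hL : ↑L ⊆ insert 0 H) (hc : c ∈ insert 0 H) (hLA : OrderConstOn L A)
    (hlt : ∀ e ∈ L, ComputableWithin H {x ∈ A | ⟪c, x⟫ < ⟪e, x⟫} g k)
    (heq : ∀ e ∈ L, ComputableWithin H {x ∈ A | ⟪c, x⟫ = ⟪e, x⟫} g k)
    (hgt : ComputableWithin H {x ∈ A | ∀ e ∈ L, ⟪e, x⟫ < ⟪c, x⟫} g k) :
    ComputableWithin H A g (k + 1) := by
  obtain rfl | hne := L.eq_empty_or_nonempty
  · exact hgt.mono (fun x hx => ⟨hx, by simp⟩) (Nat.le_succ k)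
  obtain rfl | ⟨x₀, hx₀⟩ := A.eq_empty_or_nonempty
  · exact of_const fun x hx => hx.elim
  obtain ⟨e, he, hmax⟩ := L.exists_max_image (fun e => ⟪e, x₀⟫) hne
  refine compare hH hc (hL he) (hlt e he) (heq e he) (hgt.mono (fun x hx => ⟨hx.1, ?_⟩) le_rfl)
  exact fun f hf => (hLA.inner_le hx₀ hx.1 hf he (hmax f hf)).trans_lt hx.2

theorem compare_min {L : Finset (EuclideanSpace ℝ (Fin n))} (hH : H.Nonempty)
    (hL : ↑L ⊆ insert 0 H) (hc : c ∈ insert 0 H) (hLA : OrderConstOn L A)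
    (hlt : ComputableWithin H {x ∈ A | ∀ e ∈ L, ⟪c, x⟫ < ⟪e, x⟫} g k)
    (heq : ∀ e ∈ L, ComputableWithin H {x ∈ A | ⟪c, x⟫ = ⟪e, x⟫} g k)
    (hgt : ∀ e ∈ L, ComputableWithin H {x ∈ A | ⟪e, x⟫ < ⟪c, x⟫} g k) :
    ComputableWithin H A g (k + 1) := by
  obtain rfl | hne := L.eq_empty_or_nonempty
  · exact hlt.mono (fun x hx => ⟨hx, by simp⟩) (Nat.le_succ k)
  obtain rfl | ⟨x₀, hx₀⟩ := A.eq_empty_or_nonempty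
  · exact of_const fun x hx => hx.elim
  obtain ⟨e, he, hmin⟩ := L.exists_min_image (fun e => ⟪e, x₀⟫) hne
  refine compare hH hc (hL he) (hlt.mono (fun x hx => ⟨hx.1, ?_⟩) le_rfl) (heq e he) (hgt e he)
  exact fun f hf => hx.2.trans_le (hLA.inner_le hx₀ hx.1 he hf (hmin f hf))

variable {T₀ : Set (EuclideanSpace ℝ (Fin n))} {T : Finset (EuclideanSpace ℝ (Fin n))}

/-- Two comparisons suffice: one with the largest form of `T` that exceeds `c` in at most half of
the orders, and one with the smallest of the remaining forms. -/
theorem of_orderConstOn_insert_or_halved (hH : H.Nonempty) (hT₀ : T₀.Finite)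
    (hT₀H : T₀ ⊆ insert 0 H) (hT : ↑T ⊆ T₀) (hc : c ∈ T₀) (hTA : OrderConstOn T A)
    (hg : ∀ B ⊆ A, OrderConstOn (insert c T) B ∨ 2 * numOrders T₀ B ≤ numOrders T₀ A →
      ComputableWithin H B g k) :
    ComputableWithin H A g (k + 2) := by
  classical
  set low := {e ∈ T | 2 * numOrders T₀ {x ∈ A | ⟪c, x⟫ < ⟪e, x⟫} ≤ numOrders T₀ A}
  have hlow : low ⊆ T := Finset.filter_subset _ _
  have hTH : ↑T ⊆ insert 0 H := hT.trans hT₀H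
  have heq : ∀ e ∈ T, ComputableWithin H {x ∈ A | ⟪c, x⟫ = ⟪e, x⟫} g k := fun e he =>
    hg _ (sep_subset _ _) (Or.inl
      ((hTA.mono subset_rfl (sep_subset _ _)).insert_of_eq he fun x hx => hx.2))
  have hlt : ∀ e ∈ low, ComputableWithin H {x ∈ A | ⟪c, x⟫ < ⟪e, x⟫} g k := fun e he =>
    hg _ (sep_subset _ _) (Or.inr (Finset.mem_filter.1 he).2)
  have hgt : ∀ e ∈ T \ low, ComputableWithin H {x ∈ A | ⟪e, x⟫ < ⟪c, x⟫} g k := by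
    refine fun e he => hg _ (sep_subset _ _) (Or.inr ?_)
    obtain ⟨heT, he⟩ := Finset.mem_sdiff.1 he
    have hmany : numOrders T₀ A < 2 * numOrders T₀ {x ∈ A | ⟪c, x⟫ < ⟪e, x⟫} :=
      not_le.1 fun hle => he (Finset.mem_filter.2 ⟨heT, hle⟩)
    have := numOrders_lt_add_numOrders_gt_le (A := A) hT₀ hc (hT heT)
    omega
  refine compare_max hH ((Finset.coe_subset.2 hlow).trans hTH) (hT₀H hc)
    (hTA.mono hlow subset_rfl) (fun e he => (hlt e he).mono subset_rfl k.le_succ)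
    (fun e he => (heq e (hlow he)).mono subset_rfl k.le_succ) ?_
  set B := {x ∈ A | ∀ e ∈ low, ⟪e, x⟫ < ⟪c, x⟫}
  have hBA : B ⊆ A := sep_subset _ _
  have hhigh : T \ low ⊆ T := Finset.sdiff_subset
  refine compare_min hH ((Finset.coe_subset.2 hhigh).trans hTH) (hT₀H hc) (hTA.mono hhigh hBA) ?_
    (fun e he => (heq e (hhigh he)).mono (fun x hx => ⟨hBA hx.1, hx.2⟩) le_rfl)
    (fun e he => (hgt e he).mono (fun x hx => ⟨hBA hx.1, hx.2⟩) le_rfl)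
  refine hg _ ((sep_subset _ _).trans hBA) (Or.inl
    ((hTA.mono subset_rfl ((sep_subset _ _).trans hBA)).insert_of_lt_or_gt fun e he => ?_))
  by_cases hel : e ∈ low
  · exact Or.inl fun x hx => hx.1.2 e hel
  · exact Or.inr fun x hx => hx.2 e (Finset.mem_sdiff.2 ⟨he, hel⟩)

theorem of_orderConstOn_insert (hH : H.Nonempty) (hT₀ : T₀.Finite) (hT₀H : T₀ ⊆ insert 0 H)
    (hT : ↑T ⊆ T₀) (hc : c ∈ T₀) (hTA : OrderConstOn T A)
    (hg : ∀ B ⊆ A, OrderConstOn (insert c T) B →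
      ComputableWithin H B g (k + 2 * Nat.log 2 (numOrders T₀ B))) :
    ComputableWithin H A g (k + 2 + 2 * Nat.log 2 (numOrders T₀ A)) := by
  induction hN : numOrders T₀ A using Nat.strong_induction_on generalizing A with
  | _ N ih =>
  subst hN
  rw [add_right_comm]
  refine of_orderConstOn_insert_or_halved hH hT₀ hT₀H hT hc hTA fun B hBA hB => ?_
  rcases hB with hB | hhalf
  · exact (hg B hBA hB).mono subset_rfl
      (by gcongr; exact numOrders_mono hT₀ hBA)
  · obtain rfl | hne := B.eq_empty_or_nonempty
    · exact of_const fun x hx => hx.elim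
    have hpos := numOrders_pos hT₀ hne
    have hlog : Nat.log 2 (numOrders T₀ B) + 1 ≤ Nat.log 2 (numOrders T₀ A) := by
      rw [← Nat.log_mul_base one_lt_two hpos.ne', mul_comm]
      exact Nat.log_mono_right hhalf
    exact (ih _ (by omega) (hTA.mono subset_rfl hBA) (fun C hCB => hg C (hCB.trans hBA)) rfl).mono
      subset_rfl (by omega)

theorem signVector_sub_of_orderConstOn (hH : H.Nonempty) (hT₀ : T₀.Finite)
    (hT₀H : T₀ ⊆ insert 0 H) (R : Finset (EuclideanSpace ℝ (Fin n))) (hTR : ↑T ∪ ↑R = T₀)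
    (hTA : OrderConstOn T A) :
    ComputableWithin H A (signVector (T₀ - T₀))
      (2 * #R + 2 * Nat.log 2 (numOrders T₀ A)) := by
  classical
  induction R using Finset.induction_on generalizing T A with
  | empty =>
    rw [Finset.coe_empty, union_empty] at hTR
    exact of_const fun x hx y hy => hTR ▸ hTA.signVector_sub_eq hx hy
  | insert c R hcR ih =>
    rw [Finset.card_insert_of_notMem hcR, mul_add]
    refine of_orderConstOn_insert hH hT₀ hT₀H (hTR ▸ subset_union_left)
      (hTR ▸ mem_union_right _ (Finset.mem_insert_self c R)) hTA fun B _ hB => ?_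
    refine ih (T := insert c T) ?_ (by rwa [Finset.coe_insert])
    rw [← hTR, Finset.coe_insert, Finset.coe_insert, union_insert, insert_union]

theorem signVector_queryVectors (hH : H.Nonempty) {S : Finset (EuclideanSpace ℝ (Fin n))}
    (hS : ↑S ⊆ H) :
    ComputableWithin H A (signVector (queryVectors S))
      (2 * (#S + 1) + 2 * Nat.log 2 ((2 * (#S + 1) ^ 2 + 1) ^ n)) := by
  classical
  have hfin : (insert 0 (S : Set (EuclideanSpace ℝ (Fin n)))).Finite := S.finite_toSet.insert 0
  have hsort := signVector_sub_of_orderConstOn (T := ∅) (A := A) hH hfin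
    (insert_subset_insert hS) (insert 0 S) (by simp) (by simp [OrderConstOn])
  refine (hsort.mono subset_rfl ?_).of_factors fun x _ y _ =>
    signVector_eq_of_subset (queryVectors_subset_insert_zero_sub _)
  gcongr
  · exact Finset.card_insert_le 0 S
  · simpa only [ncard_coe_finset] using numOrders_insert_zero_le S.finite_toSet

end ComputableWithin

end Sorting

section Inference

variable {H S T : Set (EuclideanSpace ℝ (Fin n))} {h x y : EuclideanSpace ℝ (Fin n)} {d k : ℕ}

theorem Infers.mono (hS : Infers S h x) (hST : S ⊆ T) : Infers T h x :=
  fun x' hx' => hS x' (signVector_eq_of_subset (queryVectors_mono hST) hx')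

theorem Infers.of_mem (hh : h ∈ S) : Infers S h x :=
  fun _ hx' => signVector_eq_signVector_iff.1 hx' h (Or.inl hh)

theorem Infers.congr (hS : Infers S h x)
    (hxy : signVector (queryVectors S) x = signVector (queryVectors S) y) : Infers S h y :=
  fun x' hx' => (hS x' (hx'.trans hxy.symm)).trans (hS y hxy.symm).symm

/-- The inference dimension of `H` is at most `d`: every `S ⊆ H` with at least `d` elements has, at
every point, an element inferred by the others. -/
def HasInferenceDimLE (H : Set (EuclideanSpace ℝ (Fin n))) (d : ℕ) : Prop :=
  ∀ S ⊆ H, (d : ℕ∞) ≤ S.encard → ∀ x, ∃ h ∈ S, Infers (S \ {h}) h x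

theorem HasInferenceDimLE.mono (hH : HasInferenceDimLE H d) (hTH : T ⊆ H) : HasInferenceDimLE T d :=
  fun S hS => hH S (hS.trans hTH)

theorem HasInferenceDimLE.two_le (hH : HasInferenceDimLE H d) (hnt : H.Nontrivial) : 2 ≤ d := by
  by_contra! hd
  obtain ⟨h, hh, hne⟩ := hnt.exists_ne 0
  obtain ⟨h', hh', hinf⟩ := hH {h} (by simpa using hh)
    (by rw [encard_singleton]; exact_mod_cast Nat.le_of_lt_succ hd) 0
  rw [mem_singleton_iff.1 hh', sdiff_self] at hinf
  have hzero := hinf h (signVector_eq_signVector_iff.2 (by simp [queryVectors]))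
  exact hne (by simpa [sign_eq_zero_iff] using hzero)

open Finset

variable {Q : Finset (EuclideanSpace ℝ (Fin n))}

theorem HasInferenceDimLE.card_le_of_closed_at (hH : HasInferenceDimLE H d) (hQH : ↑Q ⊆ H)
    (x : EuclideanSpace ℝ (Fin n)) {𝒜 : Finset (Finset (EuclideanSpace ℝ (Fin n)))}
    (h𝒜 : ∀ S ∈ 𝒜, S ⊆ Q ∧ ∀ h ∈ Q, Infers S h x → h ∈ S) :
    #𝒜 ≤ #{D ∈ Q.powerset | #D < d} := by
  classical
  refine card_le_card_filter_card_lt_of_closed (I := fun S h => Infers S h x)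
    (fun S T hST h hS => hS.mono (coe_subset.2 hST)) (fun D hDQ hdD => ?_) h𝒜
  simpa only [coe_erase, mem_coe] using hH D ((coe_subset.2 hDQ).trans hQH)
    (by rw [Set.encard_coe_eq_coe_finsetCard]; exact_mod_cast hdD) x

/-- Whether `S ⊆ Q` is closed under inference at `x` depends only on the answers at `x` to the
queries on `Q`. -/
theorem HasInferenceDimLE.card_le_of_closed (hH : HasInferenceDimLE H d) (hQH : ↑Q ⊆ H)
    {𝒜 : Finset (Finset (EuclideanSpace ℝ (Fin n)))}
    (h𝒜 : ∀ S ∈ 𝒜, S ⊆ Q ∧ ∃ x, ∀ h ∈ Q, Infers S h x → h ∈ S) :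
    #𝒜 ≤ #{D ∈ Q.powerset | #D < d} * (2 * (#Q + 1) ^ 2 + 1) ^ n := by
  classical
  choose! X hX using fun S hS => (h𝒜 S hS).2
  set f := fun S => signVector (queryVectors (Q : Set (EuclideanSpace ℝ (Fin n)))) (X S)
  have himage : #(𝒜.image f) ≤ (2 * (#Q + 1) ^ 2 + 1) ^ n := by
    have hsub := queryVectors_subset_insert_zero_sub (Q : Set (EuclideanSpace ℝ (Fin n)))
    have hle := ncard_range_signVector_le_of_subset_sub Q.finite_toSet hsub
    have hfin := finite_image_signVector ((finite_insert_zero_sub Q.finite_toSet).subset hsub) univ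
    rw [Set.image_univ] at hfin
    rw [Set.ncard_coe_finset] at hle
    rw [← Set.ncard_coe_finset, coe_image]
    refine (Set.ncard_le_ncard ?_ hfin).trans hle
    rintro _ ⟨S, -, rfl⟩
    exact ⟨X S, rfl⟩
  refine (card_le_mul_card_image 𝒜 _ fun p hp => ?_).trans (Nat.mul_le_mul_left _ himage)
  obtain ⟨S₀, -, rfl⟩ := mem_image.1 hp
  refine hH.card_le_of_closed_at hQH (X S₀) fun S hS => ?_
  obtain ⟨hS, hSS₀⟩ := mem_filter.1 hS
  have hSQ := (h𝒜 S hS).1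
  exact ⟨hSQ, fun h hh hinf => hX S hS h hh (hinf.congr
    (signVector_eq_of_subset (queryVectors_mono (coe_subset.2 hSQ)) hSS₀.symm))⟩

/-- `2 * k` is a sufficient size for a random sample to infer a quarter of any large set of
inference dimension at most `d` in `ℝⁿ`: the union of two samples has at most
`(2 * (4 * k + 1) ^ 2 + 1) ^ n` answer patterns, and by Sauer–Shelah at most `16 ^ d * 2 ^ k` of its
subsets are closed for a given pattern. -/
def IsSampleSize (n d k : ℕ) : Prop :=
  (4 * k + 1) * ((2 * (4 * k + 1) ^ 2 + 1) ^ n * 16 ^ d) < 2 ^ k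

theorem IsSampleSize.pos (hk : IsSampleSize n d k) : 0 < k := by
  by_contra! h0
  obtain rfl : k = 0 := by omega
  norm_num [IsSampleSize] at hk

theorem IsSampleSize.lt_centralBinom (hk : IsSampleSize n d k) :
    2 ^ (2 * k) * (16 ^ d * 2 ^ k * (2 * (4 * k + 1) ^ 2 + 1) ^ n) < (2 * k).centralBinom := by
  have hpos := hk.pos
  refine lt_of_mul_lt_mul_left' (a := 2 * (2 * k)) (lt_of_lt_of_le ?_
    (Nat.four_pow_le_two_mul_self_mul_centralBinom (2 * k) (by omega)))
  calc 2 * (2 * k) * (2 ^ (2 * k) * (16 ^ d * 2 ^ k * (2 * (4 * k + 1) ^ 2 + 1) ^ n))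
      = 2 ^ (3 * k) * (4 * k * ((2 * (4 * k + 1) ^ 2 + 1) ^ n * 16 ^ d)) := by ring
    _ < 2 ^ (3 * k) * 2 ^ k := by
      refine Nat.mul_lt_mul_of_pos_left (lt_of_le_of_lt ?_ hk) (by positivity)
      exact Nat.mul_le_mul_right _ (Nat.le_succ _)
    _ = 4 ^ (2 * k) := by
      rw [← pow_add, show 4 = 2 ^ 2 by rfl, ← pow_mul]
      ring_nf

theorem card_filter_card_lt_le {α : Type*} {Q : Finset α} (hQ : #Q = 4 * k) (d : ℕ) :
    #{D ∈ Q.powerset | #D < d} ≤ 16 ^ d * 2 ^ k := by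
  refine Nat.le_of_mul_le_mul_right (c := 16 ^ (4 * k)) ?_ (by positivity)
  calc #{D ∈ Q.powerset | #D < d} * 16 ^ (4 * k)
      ≤ #{D ∈ Q.powerset | #D ≤ d} * 16 ^ (4 * k) := by
        gcongr
        exact le_of_lt
    _ ≤ 16 ^ d * 17 ^ (4 * k) := hQ ▸ card_filter_card_le_mul_pow_le Q d (by norm_num)
    _ ≤ 16 ^ d * (2 ^ k * 16 ^ (4 * k)) := by
        rw [pow_mul, pow_mul, ← mul_pow]
        gcongr
        norm_num
    _ = 16 ^ d * 2 ^ k * 16 ^ (4 * k) := (mul_assoc _ _ _).symm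

open Classical in
theorem HasInferenceDimLE.exists_inferring_subset {R : Finset (EuclideanSpace ℝ (Fin n))}
    (hR : HasInferenceDimLE (R : Set (EuclideanSpace ℝ (Fin n))) d) (hk : IsSampleSize n d k)
    (hcard : 8 * k ≤ #R) :
    ∃ S ⊆ R, #S = 2 * k ∧ ∀ x, 4 * #{h ∈ R | ¬ Infers S h x} ≤ 3 * #R := by
  by_contra! hcon
  choose! X hX using hcon
  have hdouble := centralBinom_le_two_pow_mul (H := R) (m := 2 * k)
    (M := 16 ^ d * 2 ^ k * (2 * (4 * k + 1) ^ 2 + 1) ^ n) (by omega)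
    (fun S => {h ∈ R | ¬ Infers S h (X S)})
    (fun S hS => ⟨fun h hh => ?_, ?_⟩) fun Q hQ => ?_
  · exact hk.lt_centralBinom.not_ge hdouble
  · obtain ⟨hhR, hh⟩ := mem_filter.1 hh
    exact mem_sdiff.2 ⟨hhR, fun hhS => hh (.of_mem hhS)⟩
  · obtain ⟨hSR, hSk⟩ := mem_powersetCard.1 hS
    exact (hX S hSR hSk).le
  · obtain ⟨hQR, hQk⟩ := mem_powersetCard.1 hQ
    rw [show 2 * (2 * k) = 4 * k by ring] at hQk
    have hclosed := hR.card_le_of_closed (coe_subset.2 hQR)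
      (𝒜 := {S ∈ Q.powersetCard (2 * k) | Q \ S ⊆ {h ∈ R | ¬ Infers S h (X S)}}) fun S hS => ?_
    · rw [hQk] at hclosed
      exact hclosed.trans (Nat.mul_le_mul_right _ (card_filter_card_lt_le hQk d))
    · obtain ⟨hSQ, hS⟩ := mem_filter.1 hS
      refine ⟨(mem_powersetCard.1 hSQ).1, X S, fun h hh hinf => ?_⟩
      by_contra hhS
      exact (mem_filter.1 (hS (mem_sdiff.2 ⟨hh, hhS⟩))).2 hinf

end Inference

section Rounds

variable {F R : Finset (EuclideanSpace ℝ (Fin n))} {S : Set (EuclideanSpace ℝ (Fin n))}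
  {x x₀ y : EuclideanSpace ℝ (Fin n)} {d k : ℕ}

theorem IsSampleSize.log_le (hk : IsSampleSize n d k) :
    Nat.log 2 ((2 * (2 * k + 1) ^ 2 + 1) ^ n) ≤ k := by
  refine (Nat.log_mono_right ?_).trans (Nat.log_pow one_lt_two k).le
  calc (2 * (2 * k + 1) ^ 2 + 1) ^ n
      ≤ (2 * (4 * k + 1) ^ 2 + 1) ^ n := by
        gcongr
        omega
    _ ≤ (2 * (4 * k + 1) ^ 2 + 1) ^ n * 16 ^ d := Nat.le_mul_of_pos_right _ (by positivity)
    _ ≤ (4 * k + 1) * ((2 * (4 * k + 1) ^ 2 + 1) ^ n * 16 ^ d) :=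
      Nat.le_mul_of_pos_left _ (by positivity)
    _ ≤ 2 ^ k := hk.le

open Classical in
theorem signVector_eq_of_signVector_filter_not_infers_eq
    (hx : signVector (queryVectors S) x = signVector (queryVectors S) x₀)
    (hy : signVector (queryVectors S) y = signVector (queryVectors S) x₀)
    (hxy : signVector (↑{h ∈ R | ¬ Infers S h x₀} : Set (EuclideanSpace ℝ (Fin n))) x =
      signVector ↑{h ∈ R | ¬ Infers S h x₀} y) :
    signVector (R : Set (EuclideanSpace ℝ (Fin n))) x = signVector ↑R y := by
  rw [signVector_eq_signVector_iff] at hxy ⊢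
  intro h hh
  by_cases hinf : Infers S h x₀
  · exact (hinf x hx).trans (hinf y hy).symm
  · exact hxy h (Finset.mem_coe.2 (Finset.mem_filter.2 ⟨hh, hinf⟩))

namespace ComputableWithin

/-- Each round costs at most `8 * k` queries and infers a quarter of the remaining vectors. -/
theorem signVector_of_pow_mul_card_le
    (hF : HasInferenceDimLE (F : Set (EuclideanSpace ℝ (Fin n))) d)
    (hk : IsSampleSize n d k) (r : ℕ) (hR : R ⊆ F) (hr : 3 ^ r * #R ≤ 4 ^ r * (8 * k)) :
    ComputableWithin F univ (signVector (R : Set (EuclideanSpace ℝ (Fin n))))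
      ((r + 1) * (8 * k)) := by
  classical
  have hlabels := of_signVector_eq (A := univ) R (Finset.coe_subset.2 hR) fun _ _ _ _ h => h
  induction r generalizing R with
  | zero => exact hlabels.mono subset_rfl (by simpa using hr)
  | succ r ih =>
    have hkpos := hk.pos
    obtain hRk | hRk := le_or_gt #R (8 * k)
    · exact hlabels.mono subset_rfl (hRk.trans (Nat.le_mul_of_pos_left _ (by omega)))
    obtain ⟨S, hSR, hSk, hS⟩ :=
      (hF.mono (Finset.coe_subset.2 hR)).exists_inferring_subset hk (by omega)
    have hFne : (F : Set (EuclideanSpace ℝ (Fin n))).Nonempty :=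
      Finset.card_pos.1 (by have := Finset.card_le_card hR; omega)
    have hquery := signVector_queryVectors (A := univ) hFne (Finset.coe_subset.2 (hSR.trans hR))
    rw [hSk] at hquery
    have hlog := hk.log_le
    refine (hquery.bind (l := (r + 1) * (8 * k)) fun p => ?_).mono subset_rfl (by
      rw [add_mul (r + 1) 1]
      omega)
    obtain hempty | ⟨x₀, hx₀⟩ := eq_empty_or_nonempty
      {x ∈ univ | signVector (queryVectors (S : Set (EuclideanSpace ℝ (Fin n)))) x = p}
    · exact of_const fun x hx => (hempty.subset hx).elim
    have hsub : {h ∈ R | ¬ Infers S h x₀} ⊆ R := Finset.filter_subset _ _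
    have hround := ih (hsub.trans hR) ?_
      (of_signVector_eq _ (Finset.coe_subset.2 (hsub.trans hR)) fun _ _ _ _ h => h)
    · exact (hround.mono (subset_univ _) le_rfl).of_factors fun x hx y hy =>
        signVector_eq_of_signVector_filter_not_infers_eq (hx.2.trans hx₀.2.symm)
          (hy.2.trans hx₀.2.symm)
    · rw [pow_succ, pow_succ] at hr
      nlinarith [Nat.mul_le_mul_left (3 ^ r) (hS x₀)]

theorem signVector_of_isSampleSize (hcard : 2 ≤ #F)
    (hF : HasInferenceDimLE (F : Set (EuclideanSpace ℝ (Fin n))) d) (hk : IsSampleSize n d k) :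
    ComputableWithin F univ (signVector (F : Set (EuclideanSpace ℝ (Fin n))))
      (56 * k * Nat.log 2 #F) := by
  have hkpos := hk.pos
  have hlog : 1 ≤ Nat.log 2 #F := Nat.log_pos one_lt_two hcard
  refine (signVector_of_pow_mul_card_le hF hk (3 * (Nat.log 2 #F + 1)) subset_rfl ?_).mono
    subset_rfl (by nlinarith)
  have hlt : #F < 2 ^ (Nat.log 2 #F + 1) := Nat.lt_pow_succ_log_self one_lt_two _
  calc 3 ^ (3 * (Nat.log 2 #F + 1)) * #F
      ≤ 27 ^ (Nat.log 2 #F + 1) * 2 ^ (Nat.log 2 #F + 1) := by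
        rw [pow_mul]
        exact Nat.mul_le_mul (by norm_num) hlt.le
    _ = 54 ^ (Nat.log 2 #F + 1) := by
        rw [← mul_pow]
        norm_num
    _ ≤ 64 ^ (Nat.log 2 #F + 1) := Nat.pow_le_pow_left (by norm_num) _
    _ = 4 ^ (3 * (Nat.log 2 #F + 1)) := by
        rw [pow_mul 4]
        norm_num
    _ ≤ 4 ^ (3 * (Nat.log 2 #F + 1)) * (8 * k) := Nat.le_mul_of_pos_right _ (by omega)

end ComputableWithin

end Rounds

section Numerics

variable {n d l : ℕ}

theorem sampleSize_le_two_pow (hn : 1 ≤ n) (hd : 1 ≤ d) (hnd : n * d ≤ 2 ^ l) :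
    32 * (d + n * l) ≤ 2 ^ (6 + 2 * l) := by
  have hnl : n * l ≤ 2 ^ l * 2 ^ l :=
    Nat.mul_le_mul ((Nat.le_mul_of_pos_right n hd).trans hnd) Nat.lt_two_pow_self.le
  have hdl : d ≤ 2 ^ l * 2 ^ l := ((Nat.le_mul_of_pos_left d hn).trans hnd).trans
    (Nat.le_mul_of_pos_left _ (by positivity))
  calc 32 * (d + n * l) ≤ 64 * (2 ^ l * 2 ^ l) := by omega
    _ = 2 ^ (6 + 2 * l) := by ring

theorem isSampleSize_of_le_two_pow (hn : 1 ≤ n) (hd : 1 ≤ d) (hl : 2 ≤ l) (hnd : n * d ≤ 2 ^ l) :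
    IsSampleSize n d (32 * (d + n * l)) := by
  have hk := sampleSize_le_two_pow hn hd hnd
  have hpos : 1 ≤ 32 * (d + n * l) := by omega
  set k := 32 * (d + n * l) with hkdef
  have hfactor : 4 * k + 1 ≤ 2 ^ (9 + 2 * l) := by
    calc 4 * k + 1 ≤ 8 * 2 ^ (6 + 2 * l) := by omega
      _ = 2 ^ (9 + 2 * l) := by ring
  have hbase : 2 * (4 * k + 1) ^ 2 + 1 ≤ 2 ^ (18 + 4 * l) := by
    calc 2 * (4 * k + 1) ^ 2 + 1 ≤ 64 * k ^ 2 := by nlinarith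
      _ ≤ 64 * (2 ^ (6 + 2 * l)) ^ 2 := by gcongr
      _ = 2 ^ (18 + 4 * l) := by ring
  calc (4 * k + 1) * ((2 * (4 * k + 1) ^ 2 + 1) ^ n * 16 ^ d)
      ≤ 2 ^ (9 + 2 * l) * ((2 ^ (18 + 4 * l)) ^ n * (2 ^ 4) ^ d) := by
        gcongr
        norm_num
    _ = 2 ^ (9 + 2 * l + 18 * n + 4 * (n * l) + 4 * d) := by
        rw [← pow_mul, ← pow_mul]
        ring
    _ < 2 ^ k := by
        refine Nat.pow_lt_pow_right one_lt_two ?_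
        have hln : l ≤ n * l := Nat.le_mul_of_pos_left l hn
        have hnl : n * 2 ≤ n * l := Nat.mul_le_mul_left n hl
        omega

theorem natLog_two_le_two_mul_log (N : ℕ) : (Nat.log 2 N : ℝ) ≤ 2 * Real.log N := by
  have hlogb : (Nat.log 2 N : ℝ) ≤ Real.logb 2 N := by exact_mod_cast Real.natLog_le_logb N 2
  have hlog : (0 : ℝ) ≤ Real.log N := Real.log_natCast_nonneg N
  refine hlogb.trans ((div_le_iff₀ (Real.log_pos one_lt_two)).2 ?_)
  nlinarith [Real.log_two_gt_d9]

theorem mul_natLog_le_mul_log (hnd : 2 ≤ n * d) (N : ℕ) :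
    ((d + n * (Nat.log 2 (n * d) + 1) : ℕ) : ℝ) * Nat.log 2 N ≤
      8 * ((d + n * Real.log (n * d)) * Real.log N) := by
  have hone : (1 : ℝ) ≤ Nat.log 2 (n * d) := by exact_mod_cast Nat.log_pos one_lt_two hnd
  have hnatLog := natLog_two_le_two_mul_log (n * d)
  push_cast at hnatLog ⊢
  have hlog : (Nat.log 2 (n * d) : ℝ) + 1 ≤ 4 * Real.log (n * d) := by linarith
  calc (d + n * (Nat.log 2 (n * d) + 1) : ℝ) * Nat.log 2 N
      ≤ (4 * d + n * (4 * Real.log (n * d))) * (2 * Real.log N) := by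
        gcongr
        · exact add_nonneg (by positivity) (mul_nonneg n.cast_nonneg (by linarith))
        · linarith [d.cast_nonneg (α := ℝ)]
        · exact natLog_two_le_two_mul_log N
    _ = 8 * ((d + n * Real.log (n * d)) * Real.log N) := by ring

end Numerics

end PointLocation

theorem mainTheorem2 :
    ∃ C : ℝ, 0 < C ∧
      ∀ (n : ℕ) (H : Set (EuclideanSpace ℝ (Fin n))) (d : ℕ),
        H.Finite → 2 ≤ H.ncard → PointLocation.IsInferenceDimension H d →
        ∃ T : PointLocation.LinearDecisionTree n (↥H → SignType),
          T.IsComparisonTree H ∧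
          (∀ x : EuclideanSpace ℝ (Fin n), T.eval x = PointLocation.signVector H x) ∧
          ∀ x : EuclideanSpace ℝ (Fin n), (T.numQueries x : ℝ) ≤
            C * (((d : ℝ) + (n : ℝ) * Real.log ((n : ℝ) * (d : ℝ))) *
              Real.log (H.ncard : ℝ)) := by
  refine ⟨56 * 32 * 8, by norm_num, fun n H d hfin hcard hdim => ?_⟩
  lift H to Finset (EuclideanSpace ℝ (Fin n)) using hfin
  rw [Set.ncard_coe_finset] at hcard ⊢
  obtain ⟨hd, hH : PointLocation.HasInferenceDimLE _ d⟩ := hdim.1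
  have hnt : H.Nontrivial := Finset.one_lt_card_iff_nontrivial.1 hcard
  have hn : 1 ≤ n := Nat.one_le_iff_ne_zero.2 fun h0 => by
    subst h0
    obtain ⟨a, -, b, -, hab⟩ := hnt
    exact hab (Subsingleton.elim a b)
  have hnd : 2 ≤ n * d := (hH.two_le hnt).trans (Nat.le_mul_of_pos_left d hn)
  have hsize := PointLocation.isSampleSize_of_le_two_pow (l := Nat.log 2 (n * d) + 1) hn hd
    (Nat.succ_le_succ (Nat.log_pos one_lt_two hnd))
    (Nat.lt_pow_succ_log_self one_lt_two _).le
  obtain ⟨T, hT, hTx⟩ := PointLocation.ComputableWithin.signVector_of_isSampleSize hcard hH hsize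
  refine ⟨T, hT, fun x => (hTx x trivial).1, fun x => ?_⟩
  have hqueries : (T.numQueries x : ℝ) ≤
      ((56 * (32 * (d + n * (Nat.log 2 (n * d) + 1))) * Nat.log 2 H.card : ℕ) : ℝ) :=
    Nat.cast_le.2 (hTx x trivial).2
  have hlogs := PointLocation.mul_natLog_le_mul_log hnd H.card
  push_cast at hqueries hlogs
  linarith
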